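/- Let $\mu$ be a positive Borel measure on $\mathbb{R}$ whose support is not a finite set and all of whose moments are finite, $\int |x|^n\,d\mu(x)<\infty$ for $n=0,1,2,\dots$. Let $p_n$ $(n\ge 0)$ be its orthonormal polynomials, that is, $\deg p_n=n$, the leading coefficient of $p_n$ is positive, and $\int p_n p_m\,d\mu=\delta_{nm}$; let $a_n>0$, $b_n\in\mathbb{R}$ $(n\ge 1)$ be the recursion coefficients determined by $x p_n(x)=a_{n+1}p_{n+1}(x)+b_{n+1}p_n(x)+a_n p_{n-1}(x)$ (where the last term is absent for $n=0$). For $x_0\in\mathbb{R}$ and $\delta>0$ let $N_n(x_0,\delta)$ be the number of zeros of $p_n$ in $(x_0-\delta,x_0+\delta)$. **Theorem 2.** Let $x_0$ be an isolated point of $\operatorname{supp}\mu$. Then there exists $d_0>0$ such that the following hold. 1. For every $n\ge 0$, with $\delta_n=d_0^2/(d_0+\sqrt2\,a_{n+1})$, at least one of $p_n$ and $p_{n+1}$ has at most one zero in $(x_0-\delta_n,x_0+\delta_n)$. 2. If $a_\infty=\sup_{n\ge 1}a_n<\infty$ and $\delta_\infty=d_0^2/(d_0+\sqrt2\,a_\infty)$,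 then for all large $n$, either $N_n(x_0,\delta_\infty)=1$ or $N_{n+1}(x_0,\delta_\infty)=1$ (or both). -/

import Mathlib

open MeasureTheory Polynomial

noncomputable section

namespace OPRL

/-- The standing assumption on the (positive Borel) measure `μ` on the line: its support is not a
finite set, and all its moments are finite. -/
structure IsNontrivial (μ : Measure ℝ) : Prop where
  infinite_support : μ.support.Infinite
  moments : ∀ n : ℕ, Integrable (fun x : ℝ => |x| ^ n) μ

/-- The pairing `∫ f g dμ` of two real polynomials. -/
def pairing (μ : Measure ℝ) (f g : ℝ[X]) : ℝ := ∫ x, f.eval x * g.eval x ∂μ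

/-- `p` is the sequence of orthonormal polynomials of `μ`: `p n` has degree exactly `n` and positive
leading coefficient, and `∫ p n * p m dμ = δ_{nm}`. See `orthonormalPoly_spec` and
`IsOrthonormalSeq.unique` for existence and uniqueness. -/
structure IsOrthonormalSeq (μ : Measure ℝ) (p : ℕ → ℝ[X]) : Prop where
  natDegree : ∀ n, (p n).natDegree = n
  leadingCoeff_pos : ∀ n, 0 < (p n).leadingCoeff
  orthonormal : ∀ n m, ∫ x, (p n).eval x * (p m).eval x ∂μ = if n = m then 1 else 0

/-- The monic orthogonal polynomials of `μ`, by the Gram–Schmidt process applied to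
`1, x, x², …`. -/
def monicPoly (μ : Measure ℝ) (n : ℕ) : ℝ[X] :=
  X ^ n - ∑ k : Fin n,
    C (pairing μ (X ^ n) (monicPoly μ k) / pairing μ (monicPoly μ k) (monicPoly μ k)) *
      monicPoly μ k
termination_by n
decreasing_by all_goals exact k.isLt

/-- The orthonormal polynomial `p_n(x; dμ)`. -/
def orthonormalPoly (μ : Measure ℝ) (n : ℕ) : ℝ[X] :=
  C (Real.sqrt (pairing μ (monicPoly μ n) (monicPoly μ n)))⁻¹ * monicPoly μ n

/-- The recursion coefficient `a_n`, `n ≥ 1` (the value at `n = 0` is not used); see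
`recursion_zero`, `recursion_succ` and `recA_pos`. -/
def recA (μ : Measure ℝ) (n : ℕ) : ℝ :=
  ∫ x, x * (orthonormalPoly μ (n - 1)).eval x * (orthonormalPoly μ n).eval x ∂μ

/-- The recursion coefficient `b_n`, `n ≥ 1` (the value at `n = 0` is not used). -/
def recB (μ : Measure ℝ) (n : ℕ) : ℝ :=
  ∫ x, x * (orthonormalPoly μ (n - 1)).eval x * (orthonormalPoly μ (n - 1)).eval x ∂μ

/-- `N_n(x₀, δ)`: the number of zeros of `p_n` in the open interval `(x₀ - δ, x₀ + δ)`. -/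
def zeroCount (μ : Measure ℝ) (n : ℕ) (x₀ δ : ℝ) : ℕ∞ :=
  {x : ℝ | x ∈ Set.Ioo (x₀ - δ) (x₀ + δ) ∧ (orthonormalPoly μ n).eval x = 0}.encard

/-- `x₀` is an isolated point of the set `S`. -/
def IsIsolatedPoint (S : Set ℝ) (x₀ : ℝ) : Prop :=
  ∃ ε > 0, S ∩ Set.Ioo (x₀ - ε) (x₀ + ε) = {x₀}

/-! ### The objects defined above have their defining properties -/

theorem IsNontrivial.integrable_eval {μ : Measure ℝ} (h : IsNontrivial μ) (f : ℝ[X]) :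
    Integrable (fun x => f.eval x) μ := by
  induction f using Polynomial.induction_on' with
  | add p q hp hq =>
    simp only [eval_add]
    exact hp.add hq
  | monomial n a =>
    simp only [eval_monomial]
    refine Integrable.const_mul ?_ a
    refine (h.moments n).mono' (by fun_prop) (ae_of_all _ fun x => ?_)
    simp

theorem IsNontrivial.integrable_mul {μ : Measure ℝ} (h : IsNontrivial μ) (f g : ℝ[X]) :
    Integrable (fun x => f.eval x * g.eval x) μ := by
  simpa using h.integrable_eval (f * g)

theorem pairing_comm (μ : Measure ℝ) (f g : ℝ[X]) : pairing μ f g = pairing μ g f := by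
  simp [pairing, mul_comm]

theorem pairing_C_mul (μ : Measure ℝ) (c : ℝ) (f g : ℝ[X]) :
    pairing μ (C c * f) g = c * pairing μ f g := by
  simp [pairing, mul_assoc, integral_const_mul]

theorem pairing_C_mul_right (μ : Measure ℝ) (c : ℝ) (f g : ℝ[X]) :
    pairing μ f (C c * g) = c * pairing μ f g := by
  rw [pairing_comm, pairing_C_mul, pairing_comm]

theorem IsNontrivial.pairing_sub {μ : Measure ℝ} (h : IsNontrivial μ) (f₁ f₂ g : ℝ[X]) :
    pairing μ (f₁ - f₂) g = pairing μ f₁ g - pairing μ f₂ g := by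
  simp only [pairing, eval_sub, sub_mul]
  exact integral_sub (h.integrable_mul _ _) (h.integrable_mul _ _)

theorem IsNontrivial.pairing_sum {μ : Measure ℝ} (h : IsNontrivial μ) {ι : Type*} (s : Finset ι)
    (f : ι → ℝ[X]) (g : ℝ[X]) :
    pairing μ (∑ k ∈ s, f k) g = ∑ k ∈ s, pairing μ (f k) g := by
  simp only [pairing, eval_finsetSum, Finset.sum_mul]
  exact integral_finsetSum _ fun k _ => h.integrable_mul _ _

theorem IsNontrivial.pairing_self_pos {μ : Measure ℝ} (h : IsNontrivial μ) {f : ℝ[X]}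
    (hf : f ≠ 0) : 0 < pairing μ f f := by
  have h0 : 0 ≤ pairing μ f f := integral_nonneg fun x => mul_self_nonneg _
  refine lt_of_le_of_ne h0 fun he => ?_
  have h1 : (fun x => f.eval x * f.eval x) =ᵐ[μ] 0 :=
    (integral_eq_zero_iff_of_nonneg (fun x => mul_self_nonneg _) (h.integrable_mul f f)).1 he.symm
  have h2 : μ.support ⊆ {x | f.IsRoot x} := by
    refine Measure.support_subset_of_isClosed (isClosed_eq f.continuous continuous_const) ?_
    filter_upwards [h1] with x hx
    exact mul_self_eq_zero.1 hx
  exact h.infinite_support ((Polynomial.finite_setOfPred_isRoot hf).subset h2)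

theorem monicPoly_eq (μ : Measure ℝ) (n : ℕ) :
    monicPoly μ n = X ^ n - ∑ k ∈ Finset.range n,
      C (pairing μ (X ^ n) (monicPoly μ k) / pairing μ (monicPoly μ k) (monicPoly μ k)) *
        monicPoly μ k := by
  rw [monicPoly, Finset.sum_range]

theorem monicPoly_monic_natDegree (μ : Measure ℝ) (n : ℕ) :
    (monicPoly μ n).Monic ∧ (monicPoly μ n).natDegree = n := by
  induction n using Nat.strong_induction_on with
  | _ n ih =>
    have hd : (∑ k ∈ Finset.range n,
        C (pairing μ (X ^ n) (monicPoly μ k) / pairing μ (monicPoly μ k) (monicPoly μ k)) *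
          monicPoly μ k).degree < (n : WithBot ℕ) := by
      rw [← Polynomial.mem_degreeLT]
      refine Submodule.sum_mem _ fun k hk => ?_
      rw [← Polynomial.smul_eq_C_mul]
      refine Submodule.smul_mem _ _ ?_
      have hk' := Finset.mem_range.1 hk
      rw [Polynomial.mem_degreeLT, degree_eq_natDegree (ih k hk').1.ne_zero, (ih k hk').2]
      exact_mod_cast hk'
    rw [monicPoly_eq]
    have hm := monic_X_pow_sub hd
    refine ⟨hm, ?_⟩
    have : (X ^ n - _ : ℝ[X]).degree = (X ^ n : ℝ[X]).degree :=
      degree_sub_eq_left_of_degree_lt (by simpa using hd)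
    rw [natDegree_eq_of_degree_eq this, natDegree_X_pow]

theorem IsNontrivial.monicPoly_orthogonal {μ : Measure ℝ} (h : IsNontrivial μ) (n : ℕ) :
    ∀ m < n, pairing μ (monicPoly μ n) (monicPoly μ m) = 0 := by
  induction n using Nat.strong_induction_on with
  | _ n ih =>
    intro m hm
    have hpos := h.pairing_self_pos (monicPoly_monic_natDegree μ m).1.ne_zero
    rw [monicPoly_eq μ n, h.pairing_sub, h.pairing_sum, Finset.sum_eq_single m]
    · rw [pairing_C_mul, div_mul_cancel₀ _ hpos.ne', sub_self]
    · intro k hk hkm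
      rw [pairing_C_mul]
      rcases lt_or_gt_of_ne hkm with hlt | hlt
      · rw [pairing_comm μ (monicPoly μ k) (monicPoly μ m), ih m hm k hlt, mul_zero]
      · rw [ih k (Finset.mem_range.1 hk) m hlt, mul_zero]
    · intro hk
      exact absurd (Finset.mem_range.2 hm) hk

/-- The polynomials `orthonormalPoly μ n` are the orthonormal polynomials of `μ`. -/
theorem orthonormalPoly_spec {μ : Measure ℝ} (h : IsNontrivial μ) :
    IsOrthonormalSeq μ (orthonormalPoly μ) := by
  have hpos : ∀ n, 0 < (Real.sqrt (pairing μ (monicPoly μ n) (monicPoly μ n)))⁻¹ := fun n =>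
    inv_pos.2 (Real.sqrt_pos.2 (h.pairing_self_pos (monicPoly_monic_natDegree μ n).1.ne_zero))
  refine ⟨fun n => ?_, fun n => ?_, fun n m => ?_⟩
  · rw [orthonormalPoly, natDegree_C_mul (hpos n).ne', (monicPoly_monic_natDegree μ n).2]
  · rw [orthonormalPoly, leadingCoeff_mul, leadingCoeff_C,
      (monicPoly_monic_natDegree μ n).1.leadingCoeff, mul_one]
    exact hpos n
  · change pairing μ _ _ = _
    rw [orthonormalPoly, orthonormalPoly, pairing_C_mul, pairing_C_mul_right]
    split_ifs with hnm
    · subst hnm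
      have h1 := h.pairing_self_pos (monicPoly_monic_natDegree μ n).1.ne_zero
      have h2 := Real.mul_self_sqrt h1.le
      have h3 := Real.sqrt_pos.2 h1
      field_simp
      nlinarith
    · rcases lt_or_gt_of_ne hnm with hlt | hlt
      · rw [pairing_comm μ (monicPoly μ n) (monicPoly μ m), h.monicPoly_orthogonal m n hlt]; simp
      · rw [h.monicPoly_orthogonal n m hlt]; simp

theorem IsOrthonormalSeq.expand {μ : Measure ℝ} (h : IsNontrivial μ) {p : ℕ → ℝ[X]}
    (hp : IsOrthonormalSeq μ p) (N : ℕ) (f : ℝ[X]) (hf : f.degree < N) :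
    f = ∑ k ∈ Finset.range N, C (pairing μ f (p k)) * p k := by
  have key : ∀ (N : ℕ) (f : ℝ[X]), f.degree < N →
      ∃ c : ℕ → ℝ, f = ∑ k ∈ Finset.range N, C (c k) * p k := by
    intro N
    induction N with
    | zero =>
      intro f hf
      exact ⟨0, by simpa [Nat.cast_zero, Nat.WithBot.lt_zero_iff] using hf⟩
    | succ N ih =>
      intro f hf
      have hpN := (hp.leadingCoeff_pos N).ne'
      have hc : (p N).coeff N ≠ 0 := by
        have := hp.natDegree N
        rwa [leadingCoeff, this] at hpN
      obtain ⟨c, hcf⟩ := ih (f - C (f.coeff N / (p N).coeff N) * p N) (by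
        rw [degree_lt_iff_coeff_zero]
        intro m hm
        rw [coeff_sub, coeff_C_mul]
        rcases hm.eq_or_lt with rfl | hlt
        · field_simp; simp
        · rw [coeff_eq_zero_of_natDegree_lt (lt_of_eq_of_lt (hp.natDegree N) hlt),
            (degree_lt_iff_coeff_zero _ _).1 hf m hlt]
          simp)
      refine ⟨fun k => if k = N then f.coeff N / (p N).coeff N else c k, ?_⟩
      rw [Finset.sum_range_succ]
      simp only [if_true]
      rw [← sub_eq_iff_eq_add, hcf]
      refine Finset.sum_congr rfl fun k hk => ?_
      rw [if_neg (Finset.mem_range.1 hk).ne]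
  obtain ⟨c, hc⟩ := key N f hf
  have : ∀ k ∈ Finset.range N, pairing μ f (p k) = c k := by
    intro k hk
    rw [hc, h.pairing_sum, Finset.sum_eq_single k]
    · rw [pairing_C_mul, pairing, hp.orthonormal, if_pos rfl, mul_one]
    · intro j _ hj
      rw [pairing_C_mul, pairing, hp.orthonormal, if_neg hj, mul_zero]
    · intro hk'
      exact absurd hk hk'
  rw [Finset.sum_congr rfl fun k hk => by rw [this k hk]]
  exact hc

theorem IsOrthonormalSeq.degree {μ : Measure ℝ} {p : ℕ → ℝ[X]}
    (hp : IsOrthonormalSeq μ p) (n : ℕ) : (p n).degree = n := by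
  rw [degree_eq_natDegree (leadingCoeff_ne_zero.1 (hp.leadingCoeff_pos n).ne'), hp.natDegree]

theorem IsOrthonormalSeq.pairing_eq_zero {μ : Measure ℝ} (h : IsNontrivial μ) {p : ℕ → ℝ[X]}
    (hp : IsOrthonormalSeq μ p) {n : ℕ} {f : ℝ[X]} (hf : f.degree < n) :
    pairing μ f (p n) = 0 := by
  rw [hp.expand h n f hf, h.pairing_sum]
  refine Finset.sum_eq_zero fun k hk => ?_
  rw [pairing_C_mul, pairing.eq_def μ (p k), hp.orthonormal, if_neg (Finset.mem_range.1 hk).ne,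
    mul_zero]

/-- The orthonormal polynomials of `μ` are unique. -/
theorem IsOrthonormalSeq.unique {μ : Measure ℝ} (h : IsNontrivial μ) {p q : ℕ → ℝ[X]}
    (hp : IsOrthonormalSeq μ p) (hq : IsOrthonormalSeq μ q) : p = q := by
  funext n
  have h1 : p n = C (pairing μ (p n) (q n)) * q n := by
    conv_lhs => rw [hq.expand h (n + 1) (p n) (by rw [hp.degree]; exact_mod_cast n.lt_succ_self)]
    rw [Finset.sum_range_succ, Finset.sum_eq_zero, zero_add]
    intro k hk
    rw [pairing_comm, hp.pairing_eq_zero h (by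
      rw [hq.degree]; exact_mod_cast Finset.mem_range.1 hk), C_0, zero_mul]
  set c := pairing μ (p n) (q n) with hc
  have h2 : c * c = 1 := by
    have h3 := hp.orthonormal n n
    change pairing μ _ _ = _ at h3
    rw [h1, pairing_C_mul, pairing_comm, pairing_C_mul, pairing, hq.orthonormal] at h3
    simpa using h3
  have h4 : 0 < c := by
    have h5 := hp.leadingCoeff_pos n
    rw [h1, leadingCoeff_mul, leadingCoeff_C] at h5
    exact (mul_pos_iff_of_pos_right (hq.leadingCoeff_pos n)).1 h5
  have h6 : c = 1 := by nlinarith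
  rw [h1, h6, C_1, one_mul]

theorem pairing_X_mul (μ : Measure ℝ) (f g : ℝ[X]) :
    pairing μ (X * f) g = ∫ x, x * f.eval x * g.eval x ∂μ := by
  simp [pairing]

theorem pairing_X_mul_comm (μ : Measure ℝ) (f g : ℝ[X]) :
    pairing μ (X * f) g = pairing μ (X * g) f := by
  simp only [pairing_X_mul]
  congr 1
  funext x
  ring

theorem degree_X_mul_orthonormalPoly {μ : Measure ℝ} (h : IsNontrivial μ) (n : ℕ) :
    (X * orthonormalPoly μ n).degree = ((n + 1 : ℕ) : WithBot ℕ) := by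
  rw [degree_mul, degree_X, (orthonormalPoly_spec h).degree]
  push_cast
  exact add_comm _ _

/-- `x p_0 = a_1 p_1 + b_1 p_0`. -/
theorem recursion_zero {μ : Measure ℝ} (h : IsNontrivial μ) :
    X * orthonormalPoly μ 0 =
      C (recA μ 1) * orthonormalPoly μ 1 + C (recB μ 1) * orthonormalPoly μ 0 := by
  have hp := orthonormalPoly_spec h
  conv_lhs => rw [hp.expand h 2 (X * orthonormalPoly μ 0) (by
    rw [degree_X_mul_orthonormalPoly h]; norm_num)]
  rw [Finset.sum_range_succ, Finset.sum_range_one, pairing_X_mul, pairing_X_mul, recA, recB,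
    add_comm]

/-- `x p_n = a_{n+1} p_{n+1} + b_{n+1} p_n + a_n p_{n-1}` for `n ≥ 1`. -/
theorem recursion_succ {μ : Measure ℝ} (h : IsNontrivial μ) (n : ℕ) :
    X * orthonormalPoly μ (n + 1) =
      C (recA μ (n + 2)) * orthonormalPoly μ (n + 2) +
      C (recB μ (n + 2)) * orthonormalPoly μ (n + 1) +
      C (recA μ (n + 1)) * orthonormalPoly μ n := by
  have hp := orthonormalPoly_spec h
  conv_lhs => rw [hp.expand h (n + 3) (X * orthonormalPoly μ (n + 1)) (by
    rw [degree_X_mul_orthonormalPoly h]; exact_mod_cast Nat.lt_succ_self _)]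
  rw [Finset.sum_range_succ, Finset.sum_range_succ, Finset.sum_range_succ, Finset.sum_eq_zero]
  · rw [pairing_X_mul_comm μ _ (orthonormalPoly μ n)]
    simp only [pairing_X_mul, recA, recB, Nat.add_sub_cancel,
      show n + 2 - 1 = n + 1 from rfl]
    ring
  · intro k hk
    have hk' := Finset.mem_range.1 hk
    rw [pairing_X_mul_comm, hp.pairing_eq_zero h, C_0, zero_mul]
    rw [degree_X_mul_orthonormalPoly h]
    exact_mod_cast Nat.succ_lt_succ hk'

/-- `a_n > 0` for `n ≥ 1`. -/
theorem recA_pos {μ : Measure ℝ} (h : IsNontrivial μ) (n : ℕ) : 0 < recA μ (n + 1) := by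
  have hp := orthonormalPoly_spec h
  have hlt : ∀ k m : ℕ, k < m → (orthonormalPoly μ k).coeff m = 0 := fun k m hkm =>
    coeff_eq_zero_of_natDegree_lt (by rwa [hp.natDegree])
  have hlc : ∀ m, 0 < (orthonormalPoly μ m).coeff m := fun m => by
    have := hp.leadingCoeff_pos m
    rwa [leadingCoeff, hp.natDegree] at this
  have key : (orthonormalPoly μ n).coeff n =
      recA μ (n + 1) * (orthonormalPoly μ (n + 1)).coeff (n + 1) := by
    rw [← coeff_X_mul]
    cases n with
    | zero =>
      rw [recursion_zero h]
      simp [hlt 0 1 one_pos]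
    | succ n =>
      rw [recursion_succ h]
      simp [hlt (n + 1) (n + 2) (by lia), hlt n (n + 2) (by lia)]
  have h1 := hlc n
  rw [key] at h1
  exact (mul_pos_iff_of_pos_right (hlc (n + 1))).1 h1

end OPRL

end

/-!
Let `ε` be the distance from `x₀` to the rest of the support.

If `p_n` has two zeros `z₁, z₂` within `δ` of `x₀`, write `p_n = (x - z₁) (x - z₂) q`. Then
`f = (x - x₀) q` vanishes at `x₀`, and `(x - x₀) f = p_n + g` with `deg g < n` and `‖g‖ ≤ δ ‖f‖`,
because `(x - z₁) q` and `(x - z₂) q` are orthogonal. As `f` vanishes at `x₀`,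
`ε² ‖f‖² ≤ ‖(x - x₀) f‖² ≤ 1 + δ² ‖f‖²`. If `p_{n+1}` has two such zeros too, with corresponding
`f'` and `g'`, then `⟨(x - x₀) f, f'⟩ = ⟨f, (x - x₀) f'⟩` becomes
`1 / a_{n+1} = ⟨p_n, f'⟩ = ⟨f, g'⟩ - ⟨g, f'⟩ ≤ 2 δ ‖f‖ ‖f'‖`. Together these give
`ε² ≤ δ² + 2 a_{n+1} δ`, which fails for `δ = δ_n` when `d₀ = ε / 2`.

If the `a_n` are bounded, `p_n` has zeros close to `x₀`: since `∑ p_k(x₀)² ≤ 1 / μ{x₀}`, the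
Christoffel–Darboux kernels `K_n` at `x₀` satisfy `(x - x₀) K_n → 0` in `L²(μ)`, while `‖K_n‖`
stays away from `0`, and the zeros of `p_n` are the eigenvalues of multiplication by `x` compressed
to the polynomials of degree less than `n`.
-/

namespace OPRL

open Filter Topology

section RayleighRitz

variable {𝕜 E : Type*} [RCLike 𝕜] [NormedAddCommGroup E] [InnerProductSpace 𝕜 E]

theorem exists_hasEigenvalue_norm_sub_mul_le [FiniteDimensional 𝕜 E] [Nontrivial E]
    {T : E →ₗ[𝕜] E} (hT : T.IsSymmetric) (z : 𝕜) (u : E) :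
    ∃ l : ℝ, Module.End.HasEigenvalue T (l : 𝕜) ∧ ‖(l : 𝕜) - z‖ * ‖u‖ ≤ ‖T u - z • u‖ := by
  set b := hT.eigenvectorBasis rfl
  set eig := hT.eigenvalues rfl
  have : Nonempty (Fin (Module.finrank 𝕜 E)) := Fin.pos_iff_nonempty.1 Module.finrank_pos
  obtain ⟨i, hi⟩ := Finite.exists_min fun j => ‖(eig j : 𝕜) - z‖
  have hcoord : ∀ j, b.repr (T u - z • u) j = (eig j - z) * b.repr u j := fun j => by
    rw [map_sub, map_smul, PiLp.sub_apply, PiLp.smul_apply,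
      hT.eigenvectorBasis_apply_self_apply rfl u j, smul_eq_mul, sub_mul]
  have hnorm : ∀ v, ‖v‖ ^ 2 = ∑ j, ‖b.repr v j‖ ^ 2 := fun v => by
    rw [← b.repr.norm_map, EuclideanSpace.norm_sq_eq]
  refine ⟨eig i, hT.hasEigenvalue_eigenvalues rfl i,
    (sq_le_sq₀ (by positivity) (by positivity)).1 ?_⟩
  calc (‖(eig i : 𝕜) - z‖ * ‖u‖) ^ 2 = ∑ j, (‖(eig i : 𝕜) - z‖ * ‖b.repr u j‖) ^ 2 := by
        simp only [mul_pow, hnorm u, Finset.mul_sum]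
    _ ≤ ∑ j, (‖(eig j : 𝕜) - z‖ * ‖b.repr u j‖) ^ 2 := by gcongr with j; exact hi j
    _ = ‖T u - z • u‖ ^ 2 := by simp only [hnorm (T u - z • u), hcoord, norm_mul]

theorem exists_ritzValue_norm_sub_mul_le {A : E →ₗ[𝕜] E} (hA : A.IsSymmetric) (V : Submodule 𝕜 E)
    [FiniteDimensional 𝕜 V] (z : 𝕜) {u : E} (hu : u ∈ V) (hu0 : u ≠ 0) :
    ∃ l : ℝ, ∃ v ∈ V, v ≠ 0 ∧ A v - (l : 𝕜) • v ∈ Vᗮ ∧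
      ‖(l : 𝕜) - z‖ * ‖u‖ ≤ ‖A u - z • u‖ := by
  set T : V →ₗ[𝕜] V := V.orthogonalProjectionOnto.toLinearMap ∘ₗ A ∘ₗ V.subtype
  have hT : T.IsSymmetric := fun v w => by
    simpa [T] using hA v w
  have : Nontrivial V := ⟨⟨⟨u, hu⟩, 0, fun h => hu0 (congrArg Subtype.val h)⟩⟩
  obtain ⟨l, hl, hle⟩ := exists_hasEigenvalue_norm_sub_mul_le hT z ⟨u, hu⟩
  obtain ⟨v, hv⟩ := hl.exists_hasEigenvector
  have hproj : ∀ (c : 𝕜) (w : V),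
      T w - c • w = V.orthogonalProjectionOnto (A w - c • (w : E)) := fun c w => by
    simp [T]
  refine ⟨l, v, v.2, fun h => hv.2 (Subtype.ext h), ?_, hle.trans ?_⟩
  · rw [← Submodule.orthogonalProjectionOnto_eq_zero_iff, ← hproj, hv.apply_eq_smul, sub_self]
  · rw [hproj]
    exact V.norm_orthogonalProjectionOnto_apply_le _

end RayleighRitz

section Pairing

variable {μ : Measure ℝ}

theorem pairing_self_nonneg (μ : Measure ℝ) (f : ℝ[X]) : 0 ≤ pairing μ f f :=
  integral_nonneg fun _ => mul_self_nonneg _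

theorem IsNontrivial.pairing_add (h : IsNontrivial μ) (f₁ f₂ g : ℝ[X]) :
    pairing μ (f₁ + f₂) g = pairing μ f₁ g + pairing μ f₂ g := by
  simp only [pairing, eval_add, add_mul]
  exact integral_add (h.integrable_mul _ _) (h.integrable_mul _ _)

theorem IsNontrivial.pairing_add_right (h : IsNontrivial μ) (f g₁ g₂ : ℝ[X]) :
    pairing μ f (g₁ + g₂) = pairing μ f g₁ + pairing μ f g₂ := by
  simp only [pairing_comm μ f, h.pairing_add]

theorem IsNontrivial.pairing_sub_right (h : IsNontrivial μ) (f g₁ g₂ : ℝ[X]) :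
    pairing μ f (g₁ - g₂) = pairing μ f g₁ - pairing μ f g₂ := by
  simp only [pairing_comm μ f, h.pairing_sub]

theorem pairing_mul_left_comm (μ : Measure ℝ) (k f g : ℝ[X]) :
    pairing μ (k * f) g = pairing μ f (k * g) := by
  simp only [pairing, eval_mul, mul_left_comm, mul_assoc]

/-- The pairing as an inner product on the space of all polynomials, which makes the theory of
symmetric operators available. -/
noncomputable abbrev IsNontrivial.innerCore (h : IsNontrivial μ) :
    InnerProductSpace.Core ℝ ℝ[X] where
  inner := pairing μ
  conj_inner_symm f g := pairing_comm μ g f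
  re_inner_nonneg := pairing_self_nonneg μ
  add_left := h.pairing_add
  smul_left f g r := by rw [smul_eq_C_mul, pairing_C_mul]; rfl
  definite f hf := by
    by_contra hf0
    exact (h.pairing_self_pos hf0).ne' hf

/-- The norm of a polynomial in `L²(μ)`. -/
noncomputable def l2Norm (μ : Measure ℝ) (f : ℝ[X]) : ℝ := √(pairing μ f f)

theorem l2Norm_nonneg (μ : Measure ℝ) (f : ℝ[X]) : 0 ≤ l2Norm μ f := Real.sqrt_nonneg _

theorem l2Norm_sq (μ : Measure ℝ) (f : ℝ[X]) : l2Norm μ f ^ 2 = pairing μ f f :=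
  Real.sq_sqrt (pairing_self_nonneg μ f)

theorem l2Norm_C_mul (μ : Measure ℝ) (c : ℝ) (f : ℝ[X]) :
    l2Norm μ (C c * f) = |c| * l2Norm μ f := by
  rw [l2Norm, pairing_C_mul, pairing_C_mul_right, ← mul_assoc, Real.sqrt_mul (mul_self_nonneg c),
    Real.sqrt_mul_self_eq_abs, l2Norm]

theorem IsNontrivial.abs_pairing_le (h : IsNontrivial μ) (f g : ℝ[X]) :
    |pairing μ f g| ≤ l2Norm μ f * l2Norm μ g := by
  let := h.innerCore.toNormedAddCommGroup
  let := InnerProductSpace.ofCore h.innerCore.toCore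
  exact abs_real_inner_le_norm f g

theorem IsNontrivial.l2Norm_le_of_ae_abs_eval_le (h : IsNontrivial μ) {f g : ℝ[X]}
    (hfg : ∀ᵐ x ∂μ, |f.eval x| ≤ |g.eval x|) : l2Norm μ f ≤ l2Norm μ g := by
  refine Real.sqrt_le_sqrt (integral_mono_ae (h.integrable_mul f f) (h.integrable_mul g g) ?_)
  filter_upwards [hfg] with x hx
  exact abs_le_iff_mul_self_le.1 hx

theorem IsNontrivial.mul_l2Norm_le_of_eval_eq_zero (h : IsNontrivial μ) {x₀ ε : ℝ} (hε : 0 ≤ ε)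
    (hgap : ∀ᵐ x ∂μ, x ≠ x₀ → ε ≤ |x - x₀|) {f : ℝ[X]} (hf : f.eval x₀ = 0) :
    ε * l2Norm μ f ≤ l2Norm μ ((X - C x₀) * f) := by
  rw [← abs_of_nonneg hε, ← l2Norm_C_mul]
  refine h.l2Norm_le_of_ae_abs_eval_le ?_
  filter_upwards [hgap] with x hx
  rcases eq_or_ne x x₀ with rfl | hne
  · simp [hf]
  · simp only [eval_mul, eval_sub, eval_X, eval_C, abs_mul, abs_of_nonneg hε]
    gcongr
    exact hx hne

theorem IsNontrivial.measureReal_singleton_mul_eval_sq_le (h : IsNontrivial μ) (x : ℝ)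
    (f : ℝ[X]) : μ.real {x} * f.eval x ^ 2 ≤ pairing μ f f := by
  calc μ.real {x} * f.eval x ^ 2 = ∫ y in {x}, f.eval y * f.eval y ∂μ := by
        rw [integral_singleton, smul_eq_mul, pow_two]
    _ ≤ pairing μ f f :=
        setIntegral_le_integral (h.integrable_mul f f) (ae_of_all _ fun _ => mul_self_nonneg _)

end Pairing

section OrthonormalPoly

variable {μ : Measure ℝ}

theorem IsNontrivial.pairing_orthonormalPoly (h : IsNontrivial μ) (m n : ℕ) :
    pairing μ (orthonormalPoly μ m) (orthonormalPoly μ n) = if m = n then 1 else 0 :=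
  (orthonormalPoly_spec h).orthonormal m n

theorem IsNontrivial.orthonormalPoly_ne_zero (h : IsNontrivial μ) (n : ℕ) :
    orthonormalPoly μ n ≠ 0 :=
  leadingCoeff_ne_zero.1 ((orthonormalPoly_spec h).leadingCoeff_pos n).ne'

theorem IsNontrivial.eval_orthonormalPoly_zero_pos (h : IsNontrivial μ) (z : ℝ) :
    0 < (orthonormalPoly μ 0).eval z := by
  have hp := orthonormalPoly_spec h
  have hlead := hp.leadingCoeff_pos 0
  rw [leadingCoeff, hp.natDegree] at hlead
  rwa [eq_C_of_natDegree_eq_zero (hp.natDegree 0), eval_C]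

theorem IsNontrivial.pairing_X_mul_orthonormalPoly_succ (h : IsNontrivial μ) {n : ℕ} {f : ℝ[X]}
    (hf : f.degree < (n + 1 : ℕ)) :
    pairing μ (X * f) (orthonormalPoly μ (n + 1)) =
      recA μ (n + 1) * pairing μ f (orthonormalPoly μ n) := by
  have hp := orthonormalPoly_spec h
  rw [pairing_mul_left_comm, recursion_succ h, h.pairing_add_right, h.pairing_add_right,
    pairing_C_mul_right, pairing_C_mul_right, pairing_C_mul_right, hp.pairing_eq_zero h hf,
    hp.pairing_eq_zero h (hf.trans (by exact_mod_cast (n + 1).lt_succ_self))]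
  ring

theorem IsNontrivial.eval_orthonormalPoly_eq_zero_of_orthogonal (h : IsNontrivial μ) {n : ℕ}
    {l : ℝ} {f : ℝ[X]} (hf0 : f ≠ 0) (hf : f.degree < n)
    (horth : ∀ g : ℝ[X], g.degree < n → pairing μ ((X - C l) * f) g = 0) :
    (orthonormalPoly μ n).eval l = 0 := by
  have hp := orthonormalPoly_spec h
  have hdeg : ((X - C l) * f).degree < ((n + 1 : ℕ) : WithBot ℕ) := by
    rw [degree_mul, degree_X_sub_C, add_comm, Nat.cast_succ]
    exact WithBot.add_lt_add_right WithBot.one_ne_bot hf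
  have hexpand : (X - C l) * f =
      C (pairing μ ((X - C l) * f) (orthonormalPoly μ n)) * orthonormalPoly μ n := by
    conv_lhs => rw [hp.expand h (n + 1) _ hdeg]
    rw [Finset.sum_range_succ, Finset.sum_eq_zero, zero_add]
    intro k hk
    rw [horth _ (by rw [hp.degree]; exact_mod_cast Finset.mem_range.1 hk), C_0, zero_mul]
  set c := pairing μ ((X - C l) * f) (orthonormalPoly μ n)
  have hc : c ≠ 0 := fun hc => by
    rw [hc, C_0, zero_mul] at hexpand
    exact mul_ne_zero (X_sub_C_ne_zero l) hf0 hexpand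
  have heval := congrArg (eval l) hexpand
  simp only [eval_mul, eval_sub, eval_X, eval_C, sub_self, zero_mul] at heval
  exact (mul_eq_zero.1 heval.symm).resolve_left hc

/-- The zero comes as a Rayleigh–Ritz value of multiplication by `x` on the polynomials of degree
less than `n`. -/
theorem IsNontrivial.exists_zero_abs_sub_mul_l2Norm_le (h : IsNontrivial μ) {n : ℕ} {f : ℝ[X]}
    (hf0 : f ≠ 0) (hf : f.degree < n) (z : ℝ) :
    ∃ l, (orthonormalPoly μ n).eval l = 0 ∧
      |l - z| * l2Norm μ f ≤ l2Norm μ ((X - C z) * f) := by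
  let := h.innerCore.toNormedAddCommGroup
  let := InnerProductSpace.ofCore h.innerCore.toCore
  have hsymm : (LinearMap.mulLeft ℝ (X : ℝ[X])).IsSymmetric := pairing_mul_left_comm μ X
  have : FiniteDimensional ℝ (degreeLT ℝ n) := (degreeLTEquiv ℝ n).symm.finiteDimensional
  have hshift : ∀ (c : ℝ) (g : ℝ[X]), LinearMap.mulLeft ℝ X g - c • g = (X - C c) * g :=
    fun c g => by rw [LinearMap.mulLeft_apply, smul_eq_C_mul, sub_mul]
  obtain ⟨l, v, hv, hv0, horth, hle⟩ :=
    exists_ritzValue_norm_sub_mul_le hsymm (degreeLT ℝ n) z (mem_degreeLT.2 hf) hf0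
  rw [hshift] at hle
  refine ⟨l, h.eval_orthonormalPoly_eq_zero_of_orthogonal hv0 (mem_degreeLT.1 hv) fun g hg => ?_,
    hle⟩
  rw [← hshift]
  exact Submodule.inner_left_of_mem_orthogonal (mem_degreeLT.2 hg) horth

end OrthonormalPoly

section TwoZeros

variable {μ : Measure ℝ}

/-- A polynomial `f` of degree less than `n` that vanishes at `x₀` and is an approximate
eigenvector at `x₀`, with error `δ`, of multiplication by `x` compressed to the polynomials of
degree less than `n`. The part of `(x - x₀) f` removed by the compression is normalized
to be `p_n`. -/
structure IsQuasimode (μ : Measure ℝ) (n : ℕ) (x₀ δ : ℝ) (f : ℝ[X]) : Prop where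
  degree_lt : f.degree < n
  eval_eq_zero : f.eval x₀ = 0
  degree_residual_lt : ((X - C x₀) * f - orthonormalPoly μ n).degree < (n : WithBot ℕ)
  l2Norm_residual_le :
    l2Norm μ ((X - C x₀) * f - orthonormalPoly μ n) ≤ δ * l2Norm μ f

theorem IsNontrivial.l2Norm_sub_sq_of_pairing_eq_zero (h : IsNontrivial μ) {v w : ℝ[X]}
    (hvw : pairing μ v w = 0) (s t : ℝ) :
    l2Norm μ (C s * v - C t * w) ^ 2 = s ^ 2 * l2Norm μ v ^ 2 + t ^ 2 * l2Norm μ w ^ 2 := by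
  simp only [l2Norm_sq, h.pairing_sub, h.pairing_sub_right, pairing_C_mul, pairing_C_mul_right,
    hvw, pairing_comm μ w v]
  ring

theorem IsNontrivial.l2Norm_sub_le_of_pairing_eq_zero (h : IsNontrivial μ) {v w : ℝ[X]}
    (hvw : pairing μ v w = 0) {s t δ : ℝ} (hs : |s| ≤ δ) (ht : |t| ≤ δ) :
    l2Norm μ (C (s ^ 2) * v - C (t ^ 2) * w) ≤ δ * l2Norm μ (C s * v - C t * w) := by
  have hδ : 0 ≤ δ := (abs_nonneg s).trans hs
  refine (sq_le_sq₀ (l2Norm_nonneg _ _) (mul_nonneg hδ (l2Norm_nonneg _ _))).1 ?_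
  rw [mul_pow, h.l2Norm_sub_sq_of_pairing_eq_zero hvw, h.l2Norm_sub_sq_of_pairing_eq_zero hvw]
  calc (s ^ 2) ^ 2 * l2Norm μ v ^ 2 + (t ^ 2) ^ 2 * l2Norm μ w ^ 2
      = s ^ 2 * (s ^ 2 * l2Norm μ v ^ 2) + t ^ 2 * (t ^ 2 * l2Norm μ w ^ 2) := by ring
    _ ≤ δ ^ 2 * (s ^ 2 * l2Norm μ v ^ 2) + δ ^ 2 * (t ^ 2 * l2Norm μ w ^ 2) := by
        gcongr ?_ * _ + ?_ * _
        · exact sq_le_sq' (neg_le_of_abs_le hs) (le_of_abs_le hs)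
        · exact sq_le_sq' (neg_le_of_abs_le ht) (le_of_abs_le ht)
    _ = δ ^ 2 * (s ^ 2 * l2Norm μ v ^ 2 + t ^ 2 * l2Norm μ w ^ 2) := by ring

theorem degree_X_sub_C_mul_lt {q : ℝ[X]} (hq : q ≠ 0) (w z₁ z₂ : ℝ) :
    ((X - C w) * q).degree < ((X - C z₁) * (X - C z₂) * q).degree := by
  simp only [degree_mul, degree_X_sub_C, degree_eq_natDegree hq]
  norm_cast
  lia

theorem IsNontrivial.isQuasimode_of_eq_mul (h : IsNontrivial μ) {n : ℕ} {x₀ δ z₁ z₂ : ℝ}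
    (hne : z₁ ≠ z₂) (hz₁ : |z₁ - x₀| ≤ δ) (hz₂ : |z₂ - x₀| ≤ δ) {q : ℝ[X]}
    (hq : orthonormalPoly μ n = (X - C z₁) * (X - C z₂) * q) :
    IsQuasimode μ n x₀ δ ((X - C x₀) * q) := by
  have hp := orthonormalPoly_spec h
  have hq0 : q ≠ 0 := right_ne_zero_of_mul (hq ▸ h.orthonormalPoly_ne_zero n)
  have hfn : ((X - C x₀) * q).degree < (n : WithBot ℕ) := by
    rw [← hp.degree n, hq]
    exact degree_X_sub_C_mul_lt hq0 _ _ _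
  have hqn : q.degree < n :=
    (degree_le_mul_left q (X_sub_C_ne_zero x₀)).trans_lt (by rwa [mul_comm])
  set s := z₁ - x₀ with hs
  set t := z₂ - x₀ with ht
  have horth : pairing μ ((X - C z₂) * q) ((X - C z₁) * q) = 0 := by
    rw [pairing_mul_left_comm, ← mul_assoc, mul_comm (X - C z₂), ← hq]
    exact hp.pairing_eq_zero h hqn
  have hresidual : (X - C x₀) * ((X - C x₀) * q) - orthonormalPoly μ n =
      C (s + t) * ((X - C x₀) * q) - C (s * t) * q := by
    rw [hq]
    simp only [hs, ht, C_add, C_mul, C_sub]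
    ring
  have hf_comb : C (s - t) * ((X - C x₀) * q) =
      C s * ((X - C z₂) * q) - C t * ((X - C z₁) * q) := by
    simp only [hs, ht, C_sub]
    ring
  have hresidual_comb : C (s - t) * ((X - C x₀) * ((X - C x₀) * q) - orthonormalPoly μ n) =
      C (s ^ 2) * ((X - C z₂) * q) - C (t ^ 2) * ((X - C z₁) * q) := by
    rw [hresidual]
    simp only [hs, ht, C_add, C_mul, C_sub, C_pow]
    ring
  refine ⟨hfn, by simp, ?_, ?_⟩
  · rw [hresidual, ← mem_degreeLT, ← smul_eq_C_mul, ← smul_eq_C_mul]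
    exact sub_mem (Submodule.smul_mem _ _ (mem_degreeLT.2 hfn))
      (Submodule.smul_mem _ _ (mem_degreeLT.2 hqn))
  · have hst : 0 < |s - t| := abs_pos.2 (by simpa [hs, ht, sub_eq_zero] using hne)
    have hle := h.l2Norm_sub_le_of_pairing_eq_zero horth hz₁ hz₂
    rw [← hresidual_comb, ← hf_comb, l2Norm_C_mul, l2Norm_C_mul, mul_left_comm δ] at hle
    exact le_of_mul_le_mul_left hle hst

theorem IsNontrivial.exists_isQuasimode_of_two_zeros (h : IsNontrivial μ) {n : ℕ}
    {x₀ δ z₁ z₂ : ℝ} (hne : z₁ ≠ z₂) (hz₁ : |z₁ - x₀| ≤ δ) (hz₂ : |z₂ - x₀| ≤ δ)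
    (h₁ : (orthonormalPoly μ n).eval z₁ = 0) (h₂ : (orthonormalPoly μ n).eval z₂ = 0) :
    ∃ f, IsQuasimode μ n x₀ δ f := by
  obtain ⟨q, hq⟩ : (X - C z₁) * (X - C z₂) ∣ orthonormalPoly μ n :=
    (isCoprime_X_sub_C_of_isUnit_sub (sub_ne_zero.2 hne).isUnit).mul_dvd
      (dvd_iff_isRoot.2 h₁) (dvd_iff_isRoot.2 h₂)
  exact ⟨_, h.isQuasimode_of_eq_mul hne hz₁ hz₂ hq⟩

variable {n : ℕ} {x₀ δ ε : ℝ} {f f' : ℝ[X]}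

theorem IsQuasimode.pairing_residual (hf : IsQuasimode μ n x₀ δ f) (h : IsNontrivial μ) :
    pairing μ ((X - C x₀) * f - orthonormalPoly μ n) (orthonormalPoly μ n) = 0 :=
  (orthonormalPoly_spec h).pairing_eq_zero h hf.degree_residual_lt

theorem IsQuasimode.sub_mul_l2Norm_sq_le (hf : IsQuasimode μ n x₀ δ f) (h : IsNontrivial μ)
    (hε : 0 ≤ ε) (hgap : ∀ᵐ x ∂μ, x ≠ x₀ → ε ≤ |x - x₀|) :
    (ε ^ 2 - δ ^ 2) * l2Norm μ f ^ 2 ≤ 1 := by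
  set g := (X - C x₀) * f - orthonormalPoly μ n with hg
  have hsplit : (X - C x₀) * f = g + orthonormalPoly μ n := by rw [hg, sub_add_cancel]
  have horth : pairing μ g (orthonormalPoly μ n) = 0 := hf.pairing_residual h
  have hpyth : l2Norm μ ((X - C x₀) * f) ^ 2 = l2Norm μ g ^ 2 + 1 := by
    simp only [hsplit, l2Norm_sq, h.pairing_add, h.pairing_add_right, horth,
      pairing_comm μ (orthonormalPoly μ n) g, h.pairing_orthonormalPoly, if_true]
    ring
  have hlower : (ε * l2Norm μ f) ^ 2 ≤ l2Norm μ ((X - C x₀) * f) ^ 2 :=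
    pow_le_pow_left₀ (mul_nonneg hε (l2Norm_nonneg _ _))
      (h.mul_l2Norm_le_of_eval_eq_zero hε hgap hf.eval_eq_zero) 2
  have hupper : l2Norm μ g ^ 2 ≤ (δ * l2Norm μ f) ^ 2 :=
    pow_le_pow_left₀ (l2Norm_nonneg _ _) hf.l2Norm_residual_le 2
  linarith

theorem IsQuasimode.recA_mul_pairing_eq_one (hf : IsQuasimode μ (n + 1) x₀ δ f)
    (h : IsNontrivial μ) : recA μ (n + 1) * pairing μ f (orthonormalPoly μ n) = 1 := by
  have hres := hf.pairing_residual h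
  rw [h.pairing_sub, sub_mul, h.pairing_sub, pairing_C_mul, h.pairing_orthonormalPoly, if_pos rfl,
    h.pairing_X_mul_orthonormalPoly_succ hf.degree_lt,
    (orthonormalPoly_spec h).pairing_eq_zero h hf.degree_lt] at hres
  linarith

theorem IsQuasimode.one_le_mul_l2Norm (hf : IsQuasimode μ n x₀ δ f)
    (hf' : IsQuasimode μ (n + 1) x₀ δ f') (h : IsNontrivial μ) :
    1 ≤ 2 * recA μ (n + 1) * δ * (l2Norm μ f * l2Norm μ f') := by
  have ha := recA_pos h n
  set g := (X - C x₀) * f - orthonormalPoly μ n with hg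
  set g' := (X - C x₀) * f' - orthonormalPoly μ (n + 1) with hg'
  have horth : pairing μ f (orthonormalPoly μ (n + 1)) = 0 :=
    (orthonormalPoly_spec h).pairing_eq_zero h
      (hf.degree_lt.trans (by exact_mod_cast n.lt_succ_self))
  have hcross : pairing μ f' (orthonormalPoly μ n) = pairing μ f g' - pairing μ f' g := by
    rw [hg, hg', h.pairing_sub_right, h.pairing_sub_right, horth, ← pairing_mul_left_comm,
      pairing_comm μ _ f']
    ring
  have hbound : pairing μ f' (orthonormalPoly μ n) ≤ 2 * δ * (l2Norm μ f * l2Norm μ f') :=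
    calc pairing μ f' (orthonormalPoly μ n) ≤ |pairing μ f g'| + |pairing μ f' g| :=
          hcross.trans_le ((le_abs_self _).trans (abs_sub _ _))
      _ ≤ l2Norm μ f * l2Norm μ g' + l2Norm μ f' * l2Norm μ g := by
          gcongr <;> exact h.abs_pairing_le _ _
      _ ≤ l2Norm μ f * (δ * l2Norm μ f') + l2Norm μ f' * (δ * l2Norm μ f) := by
          gcongr
          exacts [l2Norm_nonneg _ _, hf'.l2Norm_residual_le, l2Norm_nonneg _ _,
            hf.l2Norm_residual_le]
      _ = 2 * δ * (l2Norm μ f * l2Norm μ f') := by ring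
  calc 1 = recA μ (n + 1) * pairing μ f' (orthonormalPoly μ n) :=
        (hf'.recA_mul_pairing_eq_one h).symm
    _ ≤ recA μ (n + 1) * (2 * δ * (l2Norm μ f * l2Norm μ f')) := by gcongr
    _ = 2 * recA μ (n + 1) * δ * (l2Norm μ f * l2Norm μ f') := by ring

theorem IsQuasimode.sq_le_of_succ (hf : IsQuasimode μ n x₀ δ f)
    (hf' : IsQuasimode μ (n + 1) x₀ δ f') (h : IsNontrivial μ) (hδ : 0 ≤ δ) (hε : 0 ≤ ε)
    (hgap : ∀ᵐ x ∂μ, x ≠ x₀ → ε ≤ |x - x₀|) :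
    ε ^ 2 ≤ δ ^ 2 + 2 * recA μ (n + 1) * δ := by
  have ha := (recA_pos h n).le
  rcases le_total (ε ^ 2 - δ ^ 2) 0 with hle | hle
  · linarith [mul_nonneg (mul_nonneg zero_le_two ha) hδ]
  have hprod : (ε ^ 2 - δ ^ 2) * (l2Norm μ f * l2Norm μ f') ≤ 1 := by
    linarith [hf.sub_mul_l2Norm_sq_le h hε hgap, hf'.sub_mul_l2Norm_sq_le h hε hgap,
      mul_nonneg hle (sq_nonneg (l2Norm μ f - l2Norm μ f'))]
  have : ε ^ 2 - δ ^ 2 ≤ 2 * recA μ (n + 1) * δ :=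
    calc ε ^ 2 - δ ^ 2
        ≤ (ε ^ 2 - δ ^ 2) * (2 * recA μ (n + 1) * δ * (l2Norm μ f * l2Norm μ f')) :=
          le_mul_of_one_le_right hle (hf.one_le_mul_l2Norm hf' h)
      _ = 2 * recA μ (n + 1) * δ * ((ε ^ 2 - δ ^ 2) * (l2Norm μ f * l2Norm μ f')) := by ring
      _ ≤ 2 * recA μ (n + 1) * δ := mul_le_of_le_one_right (by positivity) hprod
  linarith

theorem IsNontrivial.exists_isQuasimode_of_one_lt_zeroCount (h : IsNontrivial μ)
    (hn : 1 < zeroCount μ n x₀ δ) : ∃ f, IsQuasimode μ n x₀ δ f := by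
  obtain ⟨z₁, z₂, ⟨⟨a₁, b₁⟩, c₁⟩, ⟨⟨a₂, b₂⟩, c₂⟩, hne⟩ := Set.one_lt_encard_iff.1 hn
  exact h.exists_isQuasimode_of_two_zeros hne (abs_le.2 ⟨by linarith, by linarith⟩)
    (abs_le.2 ⟨by linarith, by linarith⟩) c₁ c₂

theorem IsNontrivial.zeroCount_le_one_or_succ (h : IsNontrivial μ) (hδ : 0 ≤ δ) (hε : 0 ≤ ε)
    (hgap : ∀ᵐ x ∂μ, x ≠ x₀ → ε ≤ |x - x₀|)
    (hδε : δ ^ 2 + 2 * recA μ (n + 1) * δ < ε ^ 2) :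
    zeroCount μ n x₀ δ ≤ 1 ∨ zeroCount μ (n + 1) x₀ δ ≤ 1 := by
  by_contra! hcon
  obtain ⟨f, hf⟩ := h.exists_isQuasimode_of_one_lt_zeroCount hcon.1
  obtain ⟨f', hf'⟩ := h.exists_isQuasimode_of_one_lt_zeroCount hcon.2
  exact hδε.not_ge (hf.sq_le_of_succ hf' h hδ hε hgap)

end TwoZeros

section ChristoffelDarboux

variable {μ : Measure ℝ}

/-- The Christoffel–Darboux kernel `∑_{k < n} p_k(z) p_k`, the polynomial that represents
evaluation at `z` on the polynomials of degree less than `n`. -/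
noncomputable def kernelPoly (μ : Measure ℝ) (n : ℕ) (z : ℝ) : ℝ[X] :=
  ∑ k ∈ Finset.range n, C ((orthonormalPoly μ k).eval z) * orthonormalPoly μ k

theorem kernelPoly_succ (μ : Measure ℝ) (n : ℕ) (z : ℝ) :
    kernelPoly μ (n + 1) z =
      kernelPoly μ n z + C ((orthonormalPoly μ n).eval z) * orthonormalPoly μ n :=
  Finset.sum_range_succ _ _

theorem eval_kernelPoly_self (μ : Measure ℝ) (n : ℕ) (z : ℝ) :
    (kernelPoly μ n z).eval z = ∑ k ∈ Finset.range n, (orthonormalPoly μ k).eval z ^ 2 := by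
  simp only [kernelPoly, eval_finsetSum, eval_mul, eval_C, pow_two]

theorem IsNontrivial.degree_kernelPoly_lt (h : IsNontrivial μ) (n : ℕ) (z : ℝ) :
    (kernelPoly μ n z).degree < n := by
  rw [← mem_degreeLT]
  refine Submodule.sum_mem _ fun k hk => ?_
  rw [← smul_eq_C_mul]
  refine Submodule.smul_mem _ _ (mem_degreeLT.2 ?_)
  rw [(orthonormalPoly_spec h).degree]
  exact_mod_cast Finset.mem_range.1 hk

theorem IsNontrivial.pairing_kernelPoly (h : IsNontrivial μ) {n : ℕ} {f : ℝ[X]}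
    (hf : f.degree < n) (z : ℝ) : pairing μ (kernelPoly μ n z) f = f.eval z := by
  conv_rhs => rw [(orthonormalPoly_spec h).expand h n f hf]
  simp only [kernelPoly, h.pairing_sum, pairing_C_mul, eval_finsetSum, eval_mul, eval_C]
  exact Finset.sum_congr rfl fun k _ => by rw [pairing_comm, mul_comm]

theorem IsNontrivial.l2Norm_kernelPoly_sq (h : IsNontrivial μ) (n : ℕ) (z : ℝ) :
    l2Norm μ (kernelPoly μ n z) ^ 2 =
      ∑ k ∈ Finset.range n, (orthonormalPoly μ k).eval z ^ 2 := by
  rw [l2Norm_sq, h.pairing_kernelPoly (h.degree_kernelPoly_lt n z), eval_kernelPoly_self]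

theorem IsNontrivial.eval_orthonormalPoly_zero_le_l2Norm_kernelPoly (h : IsNontrivial μ)
    (n : ℕ) (z : ℝ) : (orthonormalPoly μ 0).eval z ≤ l2Norm μ (kernelPoly μ (n + 1) z) := by
  refine le_of_sq_le_sq ?_ (l2Norm_nonneg _ _)
  rw [h.l2Norm_kernelPoly_sq]
  exact Finset.single_le_sum (f := fun k => (orthonormalPoly μ k).eval z ^ 2)
    (fun k _ => sq_nonneg _) (Finset.mem_range.2 n.succ_pos)

theorem IsNontrivial.sub_mul_kernelPoly (h : IsNontrivial μ) (z : ℝ) (n : ℕ) :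
    (X - C z) * kernelPoly μ (n + 1) z =
      C (recA μ (n + 1)) * (C ((orthonormalPoly μ n).eval z) * orthonormalPoly μ (n + 1) -
        C ((orthonormalPoly μ (n + 1)).eval z) * orthonormalPoly μ n) := by
  induction n with
  | zero =>
    have hz := congrArg (fun p => C (eval z p)) (recursion_zero h)
    simp only [eval_mul, eval_add, eval_X, eval_C, C_mul, C_add] at hz
    rw [kernelPoly, Finset.sum_range_one, zero_add]
    linear_combination C ((orthonormalPoly μ 0).eval z) * recursion_zero h -
      orthonormalPoly μ 0 * hz
  | succ n ih =>
    have hz := congrArg (fun p => C (eval z p)) (recursion_succ h n)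
    simp only [eval_mul, eval_add, eval_X, eval_C, C_mul, C_add] at hz
    rw [kernelPoly_succ, mul_add, ih]
    linear_combination C ((orthonormalPoly μ (n + 1)).eval z) * recursion_succ h n -
      orthonormalPoly μ (n + 1) * hz

theorem IsNontrivial.l2Norm_sub_mul_kernelPoly_sq (h : IsNontrivial μ) (z : ℝ) (n : ℕ) :
    l2Norm μ ((X - C z) * kernelPoly μ (n + 1) z) ^ 2 = recA μ (n + 1) ^ 2 *
      ((orthonormalPoly μ n).eval z ^ 2 + (orthonormalPoly μ (n + 1)).eval z ^ 2) := by
  have horth : pairing μ (orthonormalPoly μ (n + 1)) (orthonormalPoly μ n) = 0 := by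
    rw [h.pairing_orthonormalPoly, if_neg n.succ_ne_self]
  rw [h.sub_mul_kernelPoly, l2Norm_C_mul, mul_pow, sq_abs,
    h.l2Norm_sub_sq_of_pairing_eq_zero horth, l2Norm_sq, l2Norm_sq, h.pairing_orthonormalPoly,
    h.pairing_orthonormalPoly, if_pos rfl, if_pos rfl, mul_one, mul_one]

theorem IsNontrivial.summable_eval_orthonormalPoly_sq (h : IsNontrivial μ) {x₀ : ℝ}
    (hx₀ : 0 < μ.real {x₀}) : Summable fun k => (orthonormalPoly μ k).eval x₀ ^ 2 := by
  refine summable_of_sum_range_le (c := (μ.real {x₀})⁻¹) (fun k => sq_nonneg _) fun n => ?_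
  have hK := h.measureReal_singleton_mul_eval_sq_le x₀ (kernelPoly μ n x₀)
  rw [← l2Norm_sq, h.l2Norm_kernelPoly_sq, eval_kernelPoly_self] at hK
  set S := ∑ k ∈ Finset.range n, (orthonormalPoly μ k).eval x₀ ^ 2
  rw [← one_div, le_div_iff₀' hx₀]
  have hS0 : 0 ≤ S := Finset.sum_nonneg fun _ _ => sq_nonneg _
  rcases hS0.eq_or_lt with hS | hS
  · simp [← hS]
  · exact le_of_mul_le_mul_right (by linarith) hS

theorem IsNontrivial.tendsto_l2Norm_sub_mul_kernelPoly (h : IsNontrivial μ) {x₀ A : ℝ}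
    (hx₀ : 0 < μ.real {x₀}) (hA : ∀ n, recA μ (n + 1) ≤ A) :
    Tendsto (fun n => l2Norm μ ((X - C x₀) * kernelPoly μ (n + 1) x₀)) atTop
      (𝓝 0) := by
  have hlim := (h.summable_eval_orthonormalPoly_sq hx₀).tendsto_atTop_zero
  have hbound := (hlim.add ((tendsto_add_atTop_iff_nat 1).2 hlim)).const_mul (A ^ 2)
  rw [add_zero, mul_zero] at hbound
  have hsq : Tendsto (fun n => l2Norm μ ((X - C x₀) * kernelPoly μ (n + 1) x₀) ^ 2)
      atTop (𝓝 0) := by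
    refine squeeze_zero (fun n => sq_nonneg _) (fun n => ?_) hbound
    rw [h.l2Norm_sub_mul_kernelPoly_sq]
    have ha := (recA_pos h n).le
    gcongr
    exact hA n
  simpa [Real.sqrt_sq, l2Norm_nonneg] using hsq.sqrt

theorem IsNontrivial.eventually_one_le_zeroCount (h : IsNontrivial μ) {x₀ A δ : ℝ}
    (hx₀ : 0 < μ.real {x₀}) (hA : ∀ n, recA μ (n + 1) ≤ A) (hδ : 0 < δ) :
    ∀ᶠ n in atTop, 1 ≤ zeroCount μ n x₀ δ := by
  have hp₀ := h.eval_orthonormalPoly_zero_pos x₀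
  rw [← map_add_atTop_eq_nat 1, eventually_map]
  filter_upwards [(h.tendsto_l2Norm_sub_mul_kernelPoly hx₀ hA).eventually_lt_const
    (mul_pos hδ hp₀)] with n hn
  have hK := h.eval_orthonormalPoly_zero_le_l2Norm_kernelPoly n x₀
  have hK0 : kernelPoly μ (n + 1) x₀ ≠ 0 := fun hK0 => by
    rw [hK0] at hK
    exact absurd hK (by simpa [l2Norm, pairing] using hp₀)
  obtain ⟨l, hl, hle⟩ :=
    h.exists_zero_abs_sub_mul_l2Norm_le hK0 (h.degree_kernelPoly_lt (n + 1) x₀) x₀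
  have hlδ : |l - x₀| < δ := by
    refine lt_of_mul_lt_mul_right (hle.trans_lt (hn.trans_le ?_)) (l2Norm_nonneg _ _)
    gcongr
  obtain ⟨hl₁, hl₂⟩ := abs_lt.1 hlδ
  exact Set.one_le_encard_iff_nonempty.2 ⟨l, ⟨by linarith, by linarith⟩, hl⟩

end ChristoffelDarboux

section IsolatedPoint

variable {μ : Measure ℝ} {x₀ : ℝ}

theorem IsNontrivial.isFiniteMeasure (h : IsNontrivial μ) : IsFiniteMeasure μ := by
  have h0 := h.moments 0
  simp only [pow_zero] at h0
  exact (integrable_const_iff.1 h0).resolve_left one_ne_zero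

theorem IsIsolatedPoint.measureReal_singleton_pos [IsFiniteMeasure μ]
    (hx₀ : IsIsolatedPoint μ.support x₀) : 0 < μ.real {x₀} := by
  obtain ⟨ε, hε, hS⟩ := hx₀
  have hmem : x₀ ∈ μ.support := (hS.ge rfl).1
  have hpos : 0 < μ (Set.Ioo (x₀ - ε) (x₀ + ε)) :=
    (Measure.mem_support_iff_forall x₀).1 hmem _ (Ioo_mem_nhds (by linarith) (by linarith))
  have hle : μ (Set.Ioo (x₀ - ε) (x₀ + ε)) ≤ μ {x₀} := by
    refine measure_mono_ae ?_
    filter_upwards [Measure.support_mem_ae (μ := μ)] with x hx hxI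
    exact hS.le ⟨hx, hxI⟩
  exact ENNReal.toReal_pos (hpos.trans_le hle).ne' (measure_ne_top _ _)

theorem IsIsolatedPoint.exists_ae_le_abs_sub (hx₀ : IsIsolatedPoint μ.support x₀) :
    ∃ ε > 0, ∀ᵐ x ∂μ, x ≠ x₀ → ε ≤ |x - x₀| := by
  obtain ⟨ε, hε, hS⟩ := hx₀
  refine ⟨ε, hε, ?_⟩
  filter_upwards [Measure.support_mem_ae (μ := μ)] with x hx hne
  by_contra! hlt
  obtain ⟨h₁, h₂⟩ := abs_lt.1 hlt
  exact hne (hS.le ⟨hx, by linarith, by linarith⟩)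

end IsolatedPoint

theorem zeroCount_mono (μ : Measure ℝ) (n : ℕ) (x₀ : ℝ) : Monotone (zeroCount μ n x₀) :=
  fun _ _ hδ => Set.encard_le_encard fun _ hx =>
    ⟨Set.Ioo_subset_Ioo (by linarith) (by linarith) hx.1, hx.2⟩

theorem radius_sq_add_lt {d a : ℝ} (hd : 0 < d) (ha : 0 ≤ a) :
    (d ^ 2 / (d + √2 * a)) ^ 2 + 2 * a * (d ^ 2 / (d + √2 * a)) < (2 * d) ^ 2 := by
  set δ := d ^ 2 / (d + √2 * a)
  have hδ : 0 ≤ δ := by positivity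
  have hmul : δ * d + √2 * (a * δ) = d ^ 2 := by
    have : d + √2 * a ≠ 0 := by positivity
    simp only [δ]
    field_simp
  have hsqrt : 1 ≤ √2 := Real.one_le_sqrt.2 one_le_two
  have hδd : δ ≤ d := div_le_of_le_mul₀ (by positivity) hd.le (by
    rw [pow_two]
    gcongr
    exact le_add_of_nonneg_right (by positivity))
  calc δ ^ 2 + 2 * a * δ = δ * δ + √2 * (√2 * (a * δ)) := by
        rw [← mul_assoc √2 √2, Real.mul_self_sqrt zero_le_two]
        ring
    _ ≤ √2 * (δ * d) + √2 * (√2 * (a * δ)) := by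
        gcongr ?_ + _
        exact (mul_le_mul_of_nonneg_left hδd hδ).trans
          (le_mul_of_one_le_left (mul_nonneg hδ hd.le) hsqrt)
    _ = √2 * d ^ 2 := by rw [← mul_add, hmul]
    _ < 2 ^ 2 * d ^ 2 := by
        gcongr
        exact (Real.sqrt_lt' (by norm_num)).2 (by norm_num)
    _ = (2 * d) ^ 2 := (mul_pow 2 d 2).symm

end OPRL

theorem theorem2 (μ : MeasureTheory.Measure ℝ) (hμ : OPRL.IsNontrivial μ)
    (x₀ : ℝ) (hx₀ : OPRL.IsIsolatedPoint μ.support x₀) :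
    ∃ d₀ : ℝ, 0 < d₀ ∧
      (∀ n : ℕ,
        OPRL.zeroCount μ n x₀ (d₀ ^ 2 / (d₀ + √2 * OPRL.recA μ (n + 1))) ≤ 1 ∨
        OPRL.zeroCount μ (n + 1) x₀ (d₀ ^ 2 / (d₀ + √2 * OPRL.recA μ (n + 1))) ≤ 1) ∧
      (∀ aInf : ℝ, IsLUB {a : ℝ | ∃ n : ℕ, 1 ≤ n ∧ a = OPRL.recA μ n} aInf →
        ∀ᶠ n : ℕ in Filter.atTop,
          OPRL.zeroCount μ n x₀ (d₀ ^ 2 / (d₀ + √2 * aInf)) = 1 ∨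
          OPRL.zeroCount μ (n + 1) x₀ (d₀ ^ 2 / (d₀ + √2 * aInf)) = 1) := by
  have := hμ.isFiniteMeasure
  obtain ⟨ε, hε, hgap⟩ := hx₀.exists_ae_le_abs_sub
  have hd : 0 < ε / 2 := half_pos hε
  have hone n := hμ.zeroCount_le_one_or_succ (n := n)
    (div_nonneg (sq_nonneg _) (by have := OPRL.recA_pos hμ n; positivity)) hε.le hgap
    ((OPRL.radius_sq_add_lt hd (OPRL.recA_pos hμ n).le).trans_eq (by ring))
  refine ⟨ε / 2, hd, hone, fun A hA => ?_⟩
  have hle n : OPRL.recA μ (n + 1) ≤ A := hA.1 ⟨n + 1, n.succ_pos, rfl⟩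
  have hA0 : 0 < A := (OPRL.recA_pos hμ 0).trans_le (hle 0)
  have hzero := hμ.eventually_one_le_zeroCount hx₀.measureReal_singleton_pos hle
    (show 0 < (ε / 2) ^ 2 / (ε / 2 + √2 * A) by positivity)
  filter_upwards [hzero, (Filter.tendsto_add_atTop_nat 1).eventually hzero] with n hn hn'
  have hmono : (ε / 2) ^ 2 / (ε / 2 + √2 * A) ≤
      (ε / 2) ^ 2 / (ε / 2 + √2 * OPRL.recA μ (n + 1)) := by
    have := OPRL.recA_pos hμ n
    gcongr
    exact hle n
  exact (hone n).imp (fun h => ((OPRL.zeroCount_mono μ n x₀ hmono).trans h).antisymm hn)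
    fun h => ((OPRL.zeroCount_mono μ (n + 1) x₀ hmono).trans h).antisymm hn'
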